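/- A quiver $\Gamma=(V,E,s,r)$ consists of a set $V$ of vertices, a set $E$ of arrows and maps $s,r:E\to V$ (source and range); it is finite if $V$ and $E$ are finite. Its underlying undirected graph $|\Gamma|$ is the multigraph with vertex set $V$ in which each arrow $\alpha\in E$ gives one edge joining $s(\alpha)$ and $r(\alpha)$ (loops and multiple edges are allowed), and $\Gamma$ is connected if $|\Gamma|$ is. A Hilbert representation $(H,f)$ of $\Gamma$ consists of complex Hilbert spaces $H_v$ $(v\in V)$ and bounded linear operators $f_\alpha:H_{s(\alpha)}\to H_{r(\alpha)}$ $(\alpha\in E)$; it is zero if all $H_v$ are $0$, and infinite-dimensional if $H_v$ is infinite-dimensional for some $v\in V$. An isomorphism $(H,f)\to(K,g)$ is a family of bounded invertible operators $\varphi_v:H_v\to K_v$ with $\varphi_{r(\alpha)}f_\alpha=g_\alpha\varphi_{s(\alpha)}$ for all $\alpha\in E$. The direct sum of $(K,g)$ and $(K',g')$ has spaces $K_v\oplus K'_v$ and operators $g_\alpha\oplus g'_\alpha$. A representation is indecomposable if it is nonzero and not isomorphic to a direct sum of two nonzero Hilbert representations. The extended Dynkin diagrams are the following multigraphs. $\tilde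 A_n$ $(n\ge 0)$ is the cycle with $n+1$ vertices and $n+1$ edges (a single vertex with a loop for $n=0$, two vertices joined by two edges for $n=1$). $\tilde D_n$ $(n\ge 4)$ has vertices $0,1,\dots,n$ and consists of the path $1 - 2 - \cdots - (n-1)$ together with the edges $0 - 2$ and $(n-2) - n$. $\tilde E_6$, $\tilde E_7$ and $\tilde E_8$ are the trees consisting of three paths issuing from a common end vertex and otherwise disjoint, with $2,2,2$ edges, $1,3,3$ edges and $1,2,5$ edges respectively. **Theorem.** Let $\Gamma$ be a finite connected quiver. If its underlying undirected graph $|\Gamma|$ contains, as a (not necessarily induced) subgraph, one of the extended Dynkin diagrams $\tilde A_n$ $(n\ge 0)$, $\tilde D_n$ $(n\ge 4)$, $\tilde E_6$, $\tilde E_7$, $\tilde E_8$, then, whatever the orientation of the arrows of $\Gamma$, there exists an infinite-dimensional, indecomposable Hilbert representation $(H,f)$ of $\Gamma$ in which every Hilbert space $H_v$ is separable. -/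

import Mathlib

open scoped Graph

universe u v w

section Multigraphs

/-- The undirected multigraph (loops and parallel edges allowed) with vertex set all of `α` and
edge set all of `β`, in which the edge `e` joins the two members of `ends e`. -/
def Graph.ofEnds {α β : Type*} (ends : β → Sym2 α) : Graph α β where
  vertexSet := Set.univ
  edgeSet := Set.univ
  IsLink e x y := ends e = s(x, y)
  isLink_symm := fun _ _ => ⟨fun _ _ h => h.trans Sym2.eq_swap⟩
  eq_or_eq_of_isLink_of_isLink := by
    intro e x y v w h h'
    rcases Sym2.eq_iff.1 (h.symm.trans h') with h | h
    · exact Or.inl h.1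
    · exact Or.inr h.1
  edge_mem_iff_exists_isLink := fun e =>
    ⟨fun _ => Sym2.ind (f := fun z => ∃ x y, z = s(x, y)) (fun x y => ⟨x, y, rfl⟩) (ends e),
      fun _ => Set.mem_univ e⟩
  left_mem_of_isLink := fun _ x _ _ => Set.mem_univ x

/-- A multigraph is connected if it has a vertex and any two vertices are joined by a walk. -/
def Graph.IsConnected {α β : Type*} (G : Graph α β) : Prop :=
  V(G).Nonempty ∧ ∀ x ∈ V(G), ∀ y ∈ V(G), Relation.ReflTransGen G.Adj x y

/-- `G` contains (a copy of) `D`: there are injections of the vertices and of the edges of `D`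
into those of `G` preserving ends, i.e. `D` is isomorphic to a (not necessarily induced)
subgraph of `G`. -/
def Graph.Contains {α β γ δ : Type*} (G : Graph α β) (D : Graph γ δ) : Prop :=
  ∃ (φ : V(D) ↪ V(G)) (ψ : E(D) ↪ E(G)), ∀ (e : E(D)) (x y : V(D)),
    D.IsLink (e : δ) (x : γ) (y : γ) → G.IsLink (ψ e : β) (φ x : α) (φ y : α)

/-- The extended Dynkin diagram `Ã_n`: a cycle with `n + 1` vertices and `n + 1` edges, the `i`-th
edge joining `i` and `i + 1` modulo `n + 1`. For `n = 0` this is one vertex with a loop, for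
`n = 1` two vertices joined by two parallel edges. -/
def extendedDynkinA (n : ℕ) : Graph (Fin (n + 1)) (Fin (n + 1)) :=
  Graph.ofEnds fun i => s(i, i + 1)

/-- The extended Dynkin diagram `D̃_n`, `n ≥ 4`, with vertices `0, …, n`: a path
`1 — 2 — ⋯ — (n - 1)`, a further vertex `0` attached to `2`, and a further vertex `n` attached
to `n - 2`. The edge `0` is `0 — 2`, the edge `i` for `1 ≤ i ≤ n - 2` is `i — (i + 1)`, and the
edge `n - 1` is `(n - 2) — n`. -/
def extendedDynkinD (n : ℕ) (hn : 4 ≤ n) : Graph (Fin (n + 1)) (Fin n) :=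
  Graph.ofEnds fun i =>
    if i.val = 0 then s(⟨0, by omega⟩, ⟨2, by omega⟩)
    else if i.val = n - 1 then s(⟨n - 2, by omega⟩, ⟨n, by omega⟩)
    else s(⟨i.val, by omega⟩, ⟨i.val + 1, by omega⟩)

/-- The extended Dynkin diagram `Ẽ_6`: three arms with `2` edges each at the vertex `0`. -/
def extendedDynkinE6 : Graph (Fin 7) (Fin 6) :=
  Graph.ofEnds ![s(0, 1), s(1, 2), s(0, 3), s(3, 4), s(0, 5), s(5, 6)]

/-- The extended Dynkin diagram `Ẽ_7`: arms with `3`, `3` and `1` edges at the vertex `0`. -/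
def extendedDynkinE7 : Graph (Fin 8) (Fin 7) :=
  Graph.ofEnds ![s(0, 1), s(1, 2), s(2, 3), s(0, 4), s(4, 5), s(5, 6), s(0, 7)]

/-- The extended Dynkin diagram `Ẽ_8`: arms with `5`, `2` and `1` edges at the vertex `0`. -/
def extendedDynkinE8 : Graph (Fin 9) (Fin 8) :=
  Graph.ofEnds ![s(0, 1), s(1, 2), s(2, 3), s(3, 4), s(4, 5), s(0, 6), s(6, 7), s(0, 8)]

/-- The multigraph `G` contains one of the extended Dynkin diagrams `Ã_n` (`n ≥ 0`),
`D̃_n` (`n ≥ 4`), `Ẽ_6`, `Ẽ_7`, `Ẽ_8`. -/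
def Graph.ContainsExtendedDynkin {α β : Type*} (G : Graph α β) : Prop :=
  (∃ n : ℕ, G.Contains (extendedDynkinA n)) ∨
  (∃ (n : ℕ) (hn : 4 ≤ n), G.Contains (extendedDynkinD n hn)) ∨
  G.Contains extendedDynkinE6 ∨ G.Contains extendedDynkinE7 ∨ G.Contains extendedDynkinE8

/-- The underlying undirected multigraph of a quiver: one edge for every arrow. -/
def Quiver.underlyingGraph (Γ : Type u) [Quiver.{v} Γ] : Graph Γ (Quiver.Total Γ) :=
  Graph.ofEnds fun e => s(e.left, e.right)

end Multigraphs

section HilbertRepresentations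

/-- A Hilbert representation of a quiver `Γ`: a complex Hilbert space for every vertex and a
bounded linear operator for every arrow. -/
structure HilbertRep (Γ : Type u) [Quiver.{v} Γ] where
  space : Γ → Type w
  [normedAddCommGroup : ∀ x, NormedAddCommGroup (space x)]
  [innerProductSpace : ∀ x, InnerProductSpace ℂ (space x)]
  [completeSpace : ∀ x, CompleteSpace (space x)]
  map : ∀ {x y : Γ}, (x ⟶ y) → space x →L[ℂ] space y

attribute [instance] HilbertRep.normedAddCommGroup HilbertRep.innerProductSpace
  HilbertRep.completeSpace

namespace HilbertRep

variable {Γ : Type u} [Quiver.{v} Γ]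

/-- An isomorphism of Hilbert representations: a family of bounded invertible operators
(not necessarily unitary) intertwining the operators attached to the arrows. -/
structure Iso (H K : HilbertRep.{u, v, w} Γ) where
  equiv : ∀ x : Γ, H.space x ≃L[ℂ] K.space x
  comm : ∀ {x y : Γ} (a : x ⟶ y) (ξ : H.space x),
    equiv y (H.map a ξ) = K.map a (equiv x ξ)

/-- The direct sum of two Hilbert representations: the Hilbert space direct sum at every vertex,
and `(ξ, η) ↦ (f ξ, g η)` at every arrow. -/
noncomputable def directSum (K L : HilbertRep.{u, v, w} Γ) : HilbertRep.{u, v, w} Γ where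
  space x := WithLp 2 (K.space x × L.space x)
  map {x y} a :=
    ((WithLp.prodContinuousLinearEquiv 2 ℂ (K.space y) (L.space y)).symm :
        K.space y × L.space y →L[ℂ] WithLp 2 (K.space y × L.space y)) ∘L
      ((K.map a).prodMap (L.map a)) ∘L
      (WithLp.prodContinuousLinearEquiv 2 ℂ (K.space x) (L.space x) :
        WithLp 2 (K.space x × L.space x) →L[ℂ] K.space x × L.space x)

/-- A Hilbert representation is zero if all its spaces are zero. -/
def IsZero (H : HilbertRep.{u, v, w} Γ) : Prop :=
  ∀ x, Subsingleton (H.space x)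

/-- A Hilbert representation is decomposable if it is isomorphic to the direct sum of two nonzero
Hilbert representations. -/
def Decomposable (H : HilbertRep.{u, v, w} Γ) : Prop :=
  ∃ K L : HilbertRep.{u, v, w} Γ, ¬ K.IsZero ∧ ¬ L.IsZero ∧ Nonempty (Iso H (directSum K L))

/-- A Hilbert representation is indecomposable if it is nonzero and not decomposable. -/
def Indecomposable (H : HilbertRep.{u, v, w} Γ) : Prop :=
  ¬ H.IsZero ∧ ¬ H.Decomposable

/-- A Hilbert representation is infinite-dimensional if at least one of its spaces is. -/
def InfiniteDimensional (H : HilbertRep.{u, v, w} Γ) : Prop :=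
  ∃ x, ¬ FiniteDimensional ℂ (H.space x)

end HilbertRep

end HilbertRepresentations

/-!
The representation is built from powers of `ℓ²(ℕ)` and matrices of operators with entries in
`ℤ[S]`, where `S` is the unilateral shift. An operator commuting with `S` is determined by the
image of the first basis vector and acts on generating power series as a multiplication
(`SquareSummable.toPowerSeries_apply_of_commute`); power series form a domain, so the commutant of
`S` contains no idempotents besides `0` and `1`. A decomposition of a representation yields an
idempotent endomorphism different from `0` and `1`
(`HilbertRep.indecomposable_of_idempotents`). It is therefore enough to find, on each extended
Dynkin diagram and for each orientation, a representation whose endomorphisms are, at one vertex,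
the scalar matrices with an entry commuting with `S`, and to extend it by zero to the whole quiver
(`MatrixDiagram.exists_hilbertRep`).

The dimensions are those of the null root of the diagram. The point which makes a direct
construction possible for all orientations is that, along every arm issuing from the centre, these
dimensions decrease in equal steps `c`. Put the inclusion of a coordinate subspace on an edge
directed towards the centre and the projection along a `c`-dimensional coordinate subspace on an
edge directed away from it. Whatever the directions, the kernels and images along the arm induce
one and the same flag, with steps `c`, on the central space (`IsBlockUpper.of_edge`,
`IsBlockLower.of_edge`), and an endomorphism at the centre preserves that flag. What remains is a
configuration of flags in the central space whose common stabilizer consists of the scalars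
commuting with `S`: two opposite coordinate flags, together with one further subspace or flag
involving `S`. For `D̃_n` the spaces of the middle path are identified, which leaves four
lines in a plane, and for `Ã_n` the shift is put on one edge and the identity on the others.
-/

/-! ### The unilateral shift -/

/-- The Hilbert space `ℓ²(ℕ)` of square-summable complex sequences. -/
abbrev SquareSummable : Type := lp (fun _ : ℕ => ℂ) 2

namespace SquareSummable

/-- The unilateral shift `(x₀, x₁, …) ↦ (0, x₀, x₁, …)` on `ℓ²(ℕ)`. -/
noncomputable def shift : SquareSummable →L[ℂ] SquareSummable :=
  LinearMap.mkContinuous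
    { toFun := fun x => ⟨fun n => Nat.casesOn n 0 fun k => x k, by
        have hx := (memℓp_gen_iff (p := 2) (by norm_num)).1 x.2
        refine (memℓp_gen_iff (p := 2) (by norm_num)).2 ?_
        exact (summable_nat_add_iff 1).1 (by simpa using hx)⟩
      map_add' := by
        intro x y
        ext n
        cases n
        · exact (add_zero (0 : ℂ)).symm
        · rfl
      map_smul' := by
        intro c x
        ext n
        cases n
        · exact (mul_zero c).symm
        · rfl }
    1 (by
      intro x
      have hx := (memℓp_gen_iff (p := 2) (by norm_num)).1 x.2
      rw [one_mul, lp.norm_eq_tsum_rpow (by norm_num), lp.norm_eq_tsum_rpow (by norm_num)]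
      rw [((summable_nat_add_iff 1).1 (by simpa using hx)).tsum_eq_zero_add]
      simp)

lemma add_apply (x y : SquareSummable) (n : ℕ) : (x + y) n = x n + y n := rfl

lemma smul_apply (c : ℂ) (x : SquareSummable) (n : ℕ) : (c • x) n = c * x n := rfl

@[simp] lemma shift_zero (x : SquareSummable) : shift x 0 = 0 := rfl

@[simp] lemma shift_succ (x : SquareSummable) (n : ℕ) : shift x (n + 1) = x n := rfl

/-- The sequence `(x₁, x₂, …)`. -/
noncomputable def tail (x : SquareSummable) : SquareSummable :=
  ⟨fun n => x (n + 1), by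
    have hx := (memℓp_gen_iff (p := 2) (by norm_num)).1 x.2
    exact (memℓp_gen_iff (p := 2) (by norm_num)).2 ((summable_nat_add_iff 1).2 hx)⟩

@[simp] lemma tail_apply (x : SquareSummable) (n : ℕ) : tail x n = x (n + 1) := rfl

/-- The first vector `(1, 0, 0, …)` of the standard basis. -/
noncomputable def firstVector : SquareSummable := lp.single 2 0 1

lemma firstVector_zero : firstVector 0 = 1 := by simp [firstVector]

lemma firstVector_succ (n : ℕ) : firstVector (n + 1) = 0 := by simp [firstVector]

lemma eq_smul_firstVector_add_shift_tail (x : SquareSummable) :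
    x = x 0 • firstVector + shift (tail x) := by
  ext n
  cases n <;> rw [add_apply, smul_apply] <;> simp [firstVector_zero, firstVector_succ]

/-- The generating power series of a square-summable sequence. -/
noncomputable def toPowerSeries (x : SquareSummable) : PowerSeries ℂ := PowerSeries.mk x

lemma toPowerSeries_injective : Function.Injective toPowerSeries := by
  intro x y h
  ext n
  simpa [toPowerSeries] using congrArg (PowerSeries.coeff n) h

/-- An operator commuting with the shift acts on generating power series as the multiplication
by the series of the image of the first basis vector. -/
lemma toPowerSeries_apply_of_commute {T : SquareSummable →L[ℂ] SquareSummable}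
    (hT : T * shift = shift * T) (x : SquareSummable) :
    toPowerSeries (T x) = toPowerSeries x * toPowerSeries (T firstVector) := by
  have hS (y : SquareSummable) : T (shift y) = shift (T y) := congrArg (fun A => A y) hT
  ext n
  simp only [toPowerSeries, PowerSeries.coeff_mul, PowerSeries.coeff_mk,
    Finset.Nat.sum_antidiagonal_eq_sum_range_succ_mk]
  induction n generalizing x with
  | zero =>
    conv_lhs => rw [eq_smul_firstVector_add_shift_tail x, map_add, hS, map_smul, add_apply,
      smul_apply]
    simp
  | succ n ih =>
    conv_lhs => rw [eq_smul_firstVector_add_shift_tail x, map_add, hS, map_smul, add_apply,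
      smul_apply, shift_succ, ih]
    rw [Finset.sum_range_succ' _ (n + 1), add_comm]
    simp

/-- The commutant of the unilateral shift has no idempotents besides `0` and `1`, because
the ring of power series is a domain. -/
theorem eq_zero_or_one_of_commute_shift (T : SquareSummable →L[ℂ] SquareSummable)
    (hT : T * shift = shift * T) (hT2 : T * T = T) : T = 0 ∨ T = 1 := by
  have key := toPowerSeries_apply_of_commute hT
  have h2 : toPowerSeries (T firstVector) * toPowerSeries (T firstVector) =
      toPowerSeries (T firstVector) := by
    rw [← key]
    exact congrArg (fun A => toPowerSeries (A firstVector)) hT2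
  rcases IsIdempotentElem.iff_eq_zero_or_one.1 h2 with h | h
  · left
    ext1 x
    apply toPowerSeries_injective
    rw [key, h, mul_zero]
    rfl
  · right
    ext1 x
    apply toPowerSeries_injective
    rw [key, h, mul_one]
    rfl

lemma not_finiteDimensional : ¬ FiniteDimensional ℂ SquareSummable := by
  intro h
  have hinj : Function.Injective (shift : SquareSummable →ₗ[ℂ] SquareSummable) := by
    intro x y hxy
    ext n
    exact congrArg (fun z : SquareSummable => z (n + 1)) hxy
  obtain ⟨x, hx⟩ := LinearMap.injective_iff_surjective.1 hinj firstVector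
  have h0 : shift x 0 = firstVector 0 := congrArg (fun z : SquareSummable => z 0) hx
  rw [shift_zero, firstVector_zero] at h0
  exact zero_ne_one h0

instance separableSpace : TopologicalSpace.SeparableSpace SquareSummable := by
  let b : HilbertBasis ℕ ℂ SquareSummable := HilbertBasis.ofRepr (LinearIsometryEquiv.refl ℂ _)
  have h1 : TopologicalSpace.IsSeparable
      ((Submodule.span ℂ (Set.range b) : Submodule ℂ SquareSummable) : Set SquareSummable) :=
    (Set.countable_range b).isSeparable.span
  have h2 := h1.closure
  rw [← Submodule.topologicalClosure_coe, b.dense_span, Submodule.top_coe] at h2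
  exact TopologicalSpace.isSeparable_univ_iff.1 h2

end SquareSummable

/-! ### Idempotent endomorphisms and decompositions -/

namespace HilbertRep

variable {Γ : Type u} [Quiver.{v} Γ]

/-- A nonzero representation whose only idempotent endomorphisms are `0` and `1` is
indecomposable: a decomposition yields the projection onto its first summand. -/
theorem indecomposable_of_idempotents (H : HilbertRep.{u, v, w} Γ) (h0 : ¬ H.IsZero)
    (h : ∀ P : ∀ x, H.space x →L[ℂ] H.space x, (∀ x, P x ∘L P x = P x) →
      (∀ {x y : Γ} (a : x ⟶ y), P y ∘L H.map a = H.map a ∘L P x) →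
      (∀ x, P x = 0) ∨ (∀ x, P x = ContinuousLinearMap.id ℂ _)) :
    H.Indecomposable := by
  refine ⟨h0, ?_⟩
  rintro ⟨K, L, hK, hL, ⟨φ⟩⟩
  let q : ∀ x, (directSum K L).space x →L[ℂ] (directSum K L).space x := fun x =>
    ((WithLp.prodContinuousLinearEquiv 2 ℂ (K.space x) (L.space x)).symm :
        K.space x × L.space x →L[ℂ] WithLp 2 (K.space x × L.space x)) ∘L
      (ContinuousLinearMap.inl ℂ (K.space x) (L.space x) ∘L
        ContinuousLinearMap.fst ℂ (K.space x) (L.space x)) ∘L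
      (WithLp.prodContinuousLinearEquiv 2 ℂ (K.space x) (L.space x) :
        WithLp 2 (K.space x × L.space x) →L[ℂ] K.space x × L.space x)
  let mk : ∀ x, K.space x → L.space x → (directSum K L).space x := fun x ξ η =>
    WithLp.toLp 2 (ξ, η)
  have hq (x : Γ) (ξ : K.space x) (η : L.space x) :
      q x (mk x ξ η) = mk x ξ 0 := rfl
  have hm {x y : Γ} (a : x ⟶ y) (ξ : K.space x) (η : L.space x) :
      (directSum K L).map a (mk x ξ η) = mk y (K.map a ξ) (L.map a η) := rfl
  have hrep (x : Γ) (ζ : (directSum K L).space x) :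
      ∃ (ξ : K.space x) (η : L.space x), ζ = mk x ξ η := ⟨ζ.fst, ζ.snd, rfl⟩
  let P : ∀ x, H.space x →L[ℂ] H.space x := fun x =>
    ((φ.equiv x).symm : _ →L[ℂ] H.space x) ∘L q x ∘L (φ.equiv x : H.space x →L[ℂ] _)
  have hP (x : Γ) (ξ : H.space x) : φ.equiv x (P x ξ) = q x (φ.equiv x ξ) := by simp [P]
  have hPP (x : Γ) : P x ∘L P x = P x := by
    ext1 ξ
    apply (φ.equiv x).injective
    simp only [ContinuousLinearMap.comp_apply, hP]
    obtain ⟨ξ', η', h'⟩ := hrep x (φ.equiv x ξ)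
    rw [h', hq, hq]
  have hPa {x y : Γ} (a : x ⟶ y) : P y ∘L H.map a = H.map a ∘L P x := by
    ext1 ξ
    apply (φ.equiv y).injective
    simp only [ContinuousLinearMap.comp_apply, hP, φ.comm]
    obtain ⟨ξ', η', h'⟩ := hrep x (φ.equiv x ξ)
    rw [h', hq, hm, hm, hq, map_zero]
  rcases h P hPP hPa with hP0 | hP1
  · refine hK fun x => ⟨fun ξ η => ?_⟩
    have hz (ξ : K.space x) : ξ = 0 := by
      have := hP x ((φ.equiv x).symm (mk x ξ 0))
      rw [hP0, ContinuousLinearEquiv.apply_symm_apply, hq] at this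
      simp only [zero_apply, map_zero] at this
      exact (congrArg WithLp.fst this).symm
    rw [hz ξ, hz η]
  · refine hL fun x => ⟨fun ξ η => ?_⟩
    have hz (η : L.space x) : η = 0 := by
      have := hP x ((φ.equiv x).symm (mk x 0 η))
      rw [hP1, ContinuousLinearEquiv.apply_symm_apply, hq] at this
      simp only [ContinuousLinearMap.id_apply, ContinuousLinearEquiv.apply_symm_apply] at this
      exact congrArg WithLp.snd this
    rw [hz ξ, hz η]

end HilbertRep

/-! ### Representations given by matrices of operators -/

section Matrices

variable {R : Type*} [Ring R]

/-- The `m × n` matrix `A` satisfies `P * A = A * Q`, where `P` is `m × m` and `Q` is `n × n`.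
A matrix of any size is encoded as a function `ℕ → ℕ → R` of which only the entries inside the
relevant rectangle matter. -/
def Intertwines (m n : ℕ) (P Q A : ℕ → ℕ → R) : Prop :=
  ∀ i < m, ∀ j < n,
    ∑ k ∈ Finset.range m, P i k * A k j = ∑ k ∈ Finset.range n, A i k * Q k j

/-- The `n × n` part of `P` is `ε` times the identity matrix. -/
def IsScalarMatrix (n : ℕ) (P : ℕ → ℕ → R) (ε : R) : Prop :=
  ∀ i < n, ∀ j < n, P i j = if i = j then ε else 0

variable (R) in
/-- Representations of all orientations of a graph at once: a dimension for every vertex, and, for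
every edge between a vertex `near e` and a vertex `far e`, a matrix `inward e` used when the edge
is directed from `far e` to `near e` and a matrix `outward e` used in the opposite case. -/
structure MatrixDiagram (V E : Type*) where
  dim : V → ℕ
  near : E → V
  far : E → V
  inward : E → ℕ → ℕ → R
  outward : E → ℕ → ℕ → R

/-- For every orientation of the graph, the idempotent endomorphisms of the representation are
`0` and `1` only. -/
def MatrixDiagram.HasTrivialIdempotents {V E : Type*} (D : MatrixDiagram R V E) : Prop :=
  ∀ p : V → ℕ → ℕ → R,
    (∀ v, ∀ i < D.dim v, ∀ j < D.dim v,
      ∑ k ∈ Finset.range (D.dim v), p v i k * p v k j = p v i j) →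
    (∀ e, Intertwines (D.dim (D.near e)) (D.dim (D.far e)) (p (D.near e)) (p (D.far e))
        (D.inward e) ∨
      Intertwines (D.dim (D.far e)) (D.dim (D.near e)) (p (D.far e)) (p (D.near e))
        (D.outward e)) →
    ∃ ε : R, (ε = 0 ∨ ε = 1) ∧ ∀ v, IsScalarMatrix (D.dim v) (p v) ε

end Matrices

/-- The bounded operator between powers of a Hilbert space given by a matrix of operators. -/
noncomputable def operatorOfMatrix (m n : ℕ)
    (A : ℕ → ℕ → SquareSummable →L[ℂ] SquareSummable) :
    PiLp 2 (fun _ : Fin n => SquareSummable) →L[ℂ] PiLp 2 (fun _ : Fin m => SquareSummable) :=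
  ((PiLp.continuousLinearEquiv 2 ℂ (fun _ : Fin m => SquareSummable)).symm :
      (Fin m → SquareSummable) →L[ℂ] _) ∘L
    (ContinuousLinearMap.pi fun i => ∑ j : Fin n,
      A i j ∘L PiLp.proj 2 (fun _ : Fin n => SquareSummable) j)

lemma operatorOfMatrix_apply (m n : ℕ) (A : ℕ → ℕ → SquareSummable →L[ℂ] SquareSummable)
    (ξ : PiLp 2 (fun _ : Fin n => SquareSummable)) (i : Fin m) :
    operatorOfMatrix m n A ξ i = ∑ j : Fin n, A i j (ξ j) := by
  simp [operatorOfMatrix]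

/-- The inclusion of a power of `ℓ²(ℕ)` as one coordinate. -/
noncomputable def coordinateInclusion (n : ℕ) (j : Fin n) :
    SquareSummable →L[ℂ] PiLp 2 (fun _ : Fin n => SquareSummable) :=
  ((PiLp.continuousLinearEquiv 2 ℂ (fun _ : Fin n => SquareSummable)).symm :
      (Fin n → SquareSummable) →L[ℂ] _) ∘L
    ContinuousLinearMap.single ℂ (fun _ : Fin n => SquareSummable) j

lemma coordinateInclusion_apply (n : ℕ) (j : Fin n) (x : SquareSummable) (i : Fin n) :
    coordinateInclusion n j x i = if i = j then x else 0 := by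
  simp [coordinateInclusion]

lemma sum_coordinateInclusion (n : ℕ) (ξ : PiLp 2 (fun _ : Fin n => SquareSummable)) :
    ∑ j, coordinateInclusion n j (ξ j) = ξ := by
  ext1 i
  rw [WithLp.ofLp_sum, Finset.sum_apply]
  simp [coordinateInclusion_apply]

/-- The matrix of operators of a bounded operator on a power of `ℓ²(ℕ)`, extended by zero. -/
noncomputable def matrixOfOperator (n : ℕ)
    (T : PiLp 2 (fun _ : Fin n => SquareSummable) →L[ℂ] PiLp 2 (fun _ : Fin n => SquareSummable))
    (i j : ℕ) : SquareSummable →L[ℂ] SquareSummable :=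
  if h : i < n ∧ j < n then
    PiLp.proj 2 (fun _ : Fin n => SquareSummable) ⟨i, h.1⟩ ∘L T ∘L
      coordinateInclusion n ⟨j, h.2⟩
  else 0

lemma matrixOfOperator_apply {n : ℕ}
    (T : PiLp 2 (fun _ : Fin n => SquareSummable) →L[ℂ] PiLp 2 (fun _ : Fin n => SquareSummable))
    (i j : Fin n) (x : SquareSummable) :
    matrixOfOperator n T i j x = T (coordinateInclusion n j x) i := by
  simp [matrixOfOperator]

lemma operatorOfMatrix_matrixOfOperator {n : ℕ}
    (T : PiLp 2 (fun _ : Fin n => SquareSummable) →L[ℂ] PiLp 2 (fun _ : Fin n => SquareSummable)) :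
    operatorOfMatrix n n (matrixOfOperator n T) = T := by
  ext1 ξ
  ext1 i
  conv_rhs => rw [← sum_coordinateInclusion n ξ, map_sum, WithLp.ofLp_sum, Finset.sum_apply]
  simp [operatorOfMatrix_apply, matrixOfOperator_apply]

lemma operatorOfMatrix_comp (l m n : ℕ)
    (A B : ℕ → ℕ → SquareSummable →L[ℂ] SquareSummable) :
    operatorOfMatrix l m A ∘L operatorOfMatrix m n B =
      operatorOfMatrix l n fun i j => ∑ k ∈ Finset.range m, A i k * B k j := by
  ext1 ξ
  ext1 i
  simp only [ContinuousLinearMap.comp_apply, operatorOfMatrix_apply, map_sum,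
    sum_apply, Finset.sum_range, mul_apply_eq_comp]
  exact Finset.sum_comm

lemma operatorOfMatrix_eq_iff (m n : ℕ)
    (A B : ℕ → ℕ → SquareSummable →L[ℂ] SquareSummable) :
    operatorOfMatrix m n A = operatorOfMatrix m n B ↔ ∀ i < m, ∀ j < n, A i j = B i j := by
  constructor
  · intro h i hi j hj
    ext1 x
    have h1 := congrArg (fun T => T (coordinateInclusion n ⟨j, hj⟩ x) ⟨i, hi⟩) h
    simpa [operatorOfMatrix_apply, coordinateInclusion_apply, apply_ite] using h1
  · intro h
    ext1 ξ
    ext1 i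
    simp only [operatorOfMatrix_apply]
    exact Finset.sum_congr rfl fun j _ => by rw [h i i.2 j j.2]

lemma intertwines_matrixOfOperator {m n : ℕ}
    {P : PiLp 2 (fun _ : Fin m => SquareSummable) →L[ℂ] PiLp 2 (fun _ : Fin m => SquareSummable)}
    {Q : PiLp 2 (fun _ : Fin n => SquareSummable) →L[ℂ] PiLp 2 (fun _ : Fin n => SquareSummable)}
    {A : ℕ → ℕ → SquareSummable →L[ℂ] SquareSummable}
    (h : P ∘L operatorOfMatrix m n A = operatorOfMatrix m n A ∘L Q) :
    Intertwines m n (matrixOfOperator m P) (matrixOfOperator n Q) A := by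
  rw [← operatorOfMatrix_matrixOfOperator P, ← operatorOfMatrix_matrixOfOperator Q,
    operatorOfMatrix_comp, operatorOfMatrix_comp, operatorOfMatrix_eq_iff] at h
  exact h

lemma matrixOfOperator_mul_self {n : ℕ}
    {P : PiLp 2 (fun _ : Fin n => SquareSummable) →L[ℂ] PiLp 2 (fun _ : Fin n => SquareSummable)}
    (h : P ∘L P = P) : ∀ i < n, ∀ j < n,
      ∑ k ∈ Finset.range n, matrixOfOperator n P i k * matrixOfOperator n P k j =
        matrixOfOperator n P i j := by
  rw [← operatorOfMatrix_matrixOfOperator P, operatorOfMatrix_comp, operatorOfMatrix_eq_iff] at h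
  exact h

lemma eq_smul_id_of_isScalarMatrix {n : ℕ}
    {P : PiLp 2 (fun _ : Fin n => SquareSummable) →L[ℂ] PiLp 2 (fun _ : Fin n => SquareSummable)}
    {c : ℂ} (h : IsScalarMatrix n (matrixOfOperator n P) (c • 1)) :
    P = c • ContinuousLinearMap.id ℂ _ := by
  rw [← operatorOfMatrix_matrixOfOperator P]
  ext1 ξ
  ext1 i
  rw [operatorOfMatrix_apply, Finset.sum_eq_single i]
  · simp [h i i.2 i i.2]
  · intro j _ hj
    simp [h i i.2 j j.2, Fin.val_ne_of_ne hj.symm]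
  · simp

/-- The representation of a quiver by powers of `ℓ²(ℕ)` and matrices of operators. -/
noncomputable def HilbertRep.ofMatrices {Γ : Type u} [Quiver.{v} Γ] (n : Γ → ℕ)
    (A : Quiver.Total Γ → ℕ → ℕ → SquareSummable →L[ℂ] SquareSummable) :
    HilbertRep.{u, v, 0} Γ where
  space x := PiLp 2 fun _ : Fin (n x) => SquareSummable
  map {x y} a := operatorOfMatrix (n y) (n x) (A ⟨x, y, a⟩)

/-- Extension by zero along an embedding of a diagram into the underlying graph of a quiver: the
other vertices get the zero space, and every arrow of the diagram gets the matrix belonging to its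
direction. -/
theorem MatrixDiagram.exists_hilbertRep {Γ : Type u} [Quiver.{v} Γ] {V E : Type*}
    (D : MatrixDiagram (SquareSummable →L[ℂ] SquareSummable) V E)
    (hD : D.HasTrivialIdempotents) (v₀ : V) (hv₀ : 0 < D.dim v₀)
    (hG : (Quiver.underlyingGraph Γ).Contains (Graph.ofEnds fun e => s(D.near e, D.far e))) :
    ∃ H : HilbertRep.{u, v, 0} Γ,
      (∀ x : Γ, TopologicalSpace.SeparableSpace (H.space x)) ∧
      H.InfiniteDimensional ∧ H.Indecomposable := by
  obtain ⟨φ', ψ', hφψ⟩ := hG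
  let φ : V → Γ := fun x => φ' ⟨x, trivial⟩
  let ψ : E → Quiver.Total Γ := fun e => ψ' ⟨e, trivial⟩
  have hφ : Function.Injective φ := fun x y h =>
    congrArg Subtype.val (φ'.injective (Subtype.ext h))
  have hψ : Function.Injective ψ := fun x y h =>
    congrArg Subtype.val (ψ'.injective (Subtype.ext h))
  have hends (e : E) : s((ψ e).left, (ψ e).right) = s(φ (D.near e), φ (D.far e)) :=
    hφψ ⟨e, trivial⟩ ⟨D.near e, trivial⟩ ⟨D.far e, trivial⟩ rfl
  clear_value φ ψ
  clear hφψ ψ' φ'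
  classical
  let n : Γ → ℕ := Function.extend φ D.dim 0
  let A : Quiver.Total Γ → ℕ → ℕ → SquareSummable →L[ℂ] SquareSummable :=
    Function.extend ψ (fun e =>
      if (ψ e).left = φ (D.far e) ∧ (ψ e).right = φ (D.near e) then D.inward e
      else D.outward e) 0
  have hn (x : V) : n (φ x) = D.dim x := hφ.extend_apply _ _ x
  have hn0 (z : Γ) (hz : ¬ ∃ x, φ x = z) : n z = 0 := Function.extend_apply' _ _ z hz
  have hA (e : E) : A (ψ e) = if (ψ e).left = φ (D.far e) ∧ (ψ e).right = φ (D.near e)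
      then D.inward e else D.outward e := hψ.extend_apply _ _ e
  have hv : ¬ FiniteDimensional ℂ ((HilbertRep.ofMatrices n A).space (φ v₀)) := by
    intro hfin
    change FiniteDimensional ℂ (PiLp 2 fun _ : Fin (n (φ v₀)) => SquareSummable) at hfin
    have h0 : 0 < n (φ v₀) := (hn v₀).symm ▸ hv₀
    refine SquareSummable.not_finiteDimensional
      (FiniteDimensional.of_injective
        (coordinateInclusion (n (φ v₀)) ⟨0, h0⟩).toLinearMap fun x y hxy => ?_)
    have := congrArg
      (fun ξ : PiLp 2 (fun _ : Fin (n (φ v₀)) => SquareSummable) => ξ ⟨0, h0⟩) hxy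
    simpa [coordinateInclusion_apply] using this
  refine ⟨HilbertRep.ofMatrices n A, fun x => ?_, ⟨φ v₀, hv⟩, ?_⟩
  · exact (PiLp.continuousLinearEquiv 2 ℂ (fun _ : Fin (n x) => SquareSummable)).symm
      |>.surjective.denseRange.separableSpace (ContinuousLinearEquiv.continuous _)
  apply HilbertRep.indecomposable_of_idempotents
  · intro hzero
    have := hzero (φ v₀)
    exact hv inferInstance
  intro P hPP hPa
  have hPa' (a : Quiver.Total Γ) :
      Intertwines (n a.right) (n a.left) (matrixOfOperator _ (P a.right))
        (matrixOfOperator _ (P a.left)) (A a) :=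
    intertwines_matrixOfOperator (hPa a.hom)
  have hidem (x : V) : ∀ i < D.dim x, ∀ j < D.dim x, ∑ k ∈ Finset.range (D.dim x),
      matrixOfOperator _ (P (φ x)) i k * matrixOfOperator _ (P (φ x)) k j =
        matrixOfOperator _ (P (φ x)) i j := by
    rw [← hn]
    exact matrixOfOperator_mul_self (hPP (φ x))
  have hedge (e : E) :
      Intertwines (D.dim (D.near e)) (D.dim (D.far e)) (matrixOfOperator _ (P (φ (D.near e))))
        (matrixOfOperator _ (P (φ (D.far e)))) (D.inward e) ∨
      Intertwines (D.dim (D.far e)) (D.dim (D.near e)) (matrixOfOperator _ (P (φ (D.far e))))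
        (matrixOfOperator _ (P (φ (D.near e)))) (D.outward e) := by
    have h := hPa' (ψ e)
    rw [hA] at h
    rcases Sym2.eq_iff.1 (hends e) with ⟨h1, h2⟩ | ⟨h1, h2⟩
    · rw [h1, h2] at h
      simp only [hn] at h
      split_ifs at h with h3
      · -- The arrow matches the edge in both directions, so the edge is a loop.
        left
        rw [hφ h3.1] at h ⊢
        exact h
      · right
        exact h
    · rw [h1, h2] at h
      simp only [hn] at h
      left
      simpa using h
  obtain ⟨ε, hε, hscal⟩ := hD _ hidem hedge
  have hall (z : Γ) : IsScalarMatrix (n z) (matrixOfOperator _ (P z)) ε := by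
    by_cases hz : ∃ x, φ x = z
    · obtain ⟨x, rfl⟩ := hz
      intro i hi j hj
      rw [hn] at hi hj
      exact hscal x i hi j hj
    · intro i hi
      rw [hn0 z hz] at hi
      exact absurd hi (Nat.not_lt_zero i)
  rcases hε with rfl | rfl
  · left
    intro x
    have := eq_smul_id_of_isScalarMatrix (c := 0) (by rw [zero_smul]; exact hall x)
    exact this.trans (zero_smul ℂ (ContinuousLinearMap.id ℂ
        (PiLp 2 fun _ : Fin (n x) => SquareSummable)))
  · right
    intro x
    have := eq_smul_id_of_isScalarMatrix (c := 1) (by rw [one_smul]; exact hall x)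
    exact this.trans (one_smul ℂ (ContinuousLinearMap.id ℂ
        (PiLp 2 fun _ : Fin (n x) => SquareSummable)))

/-! ### Arms of flags -/

section Arms

variable {R : Type*} [Ring R]

/-- The matrix of the inclusion `x ↦ (0, …, 0, x, 0, …)` starting at the coordinate `c`. -/
def inclusionMatrix (R : Type*) [Ring R] (c i j : ℕ) : R := if i = j + c then 1 else 0

/-- The matrix of the projection forgetting the first `c` coordinates (and, according to the size
of the target, some of the last ones). -/
def projectionMatrix (R : Type*) [Ring R] (c i j : ℕ) : R := if j = i + c then 1 else 0

/-- `P` is upper triangular in blocks of size `c`. -/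
def IsBlockUpper (c n : ℕ) (P : ℕ → ℕ → R) : Prop :=
  ∀ i < n, ∀ j < n, j / c < i / c → P i j = 0

/-- `P` is lower triangular in blocks of size `c`. -/
def IsBlockLower (c n : ℕ) (P : ℕ → ℕ → R) : Prop :=
  ∀ i < n, ∀ j < n, i / c < j / c → P i j = 0

lemma isBlockUpper_self (c : ℕ) (P : ℕ → ℕ → R) : IsBlockUpper c c P := by
  intro i hi j hj h
  rw [Nat.div_eq_of_lt hi] at h
  exact absurd h (Nat.not_lt_zero _)

lemma isBlockLower_self (c : ℕ) (P : ℕ → ℕ → R) : IsBlockLower c c P := by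
  intro i hi j hj h
  rw [Nat.div_eq_of_lt hj] at h
  exact absurd h (Nat.not_lt_zero _)

lemma Intertwines.apply_of_inclusion {m n c : ℕ} {P Q : ℕ → ℕ → R}
    (h : Intertwines m n P Q (inclusionMatrix R c)) (hm : n + c ≤ m) {i j : ℕ} (hi : i < m)
    (hj : j < n) : P i (j + c) = if c ≤ i ∧ i - c < n then Q (i - c) j else 0 := by
  have h1 := h i hi j hj
  simp only [inclusionMatrix, mul_ite, mul_one, mul_zero, ite_mul, one_mul, zero_mul] at h1
  rw [Finset.sum_ite_eq' , if_pos (Finset.mem_range.2 (by omega))] at h1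
  rw [h1]
  split_ifs with h2
  · rw [Finset.sum_eq_single (i - c)]
    · rw [if_pos (by omega)]
    · intro k _ hk
      rw [if_neg (by omega)]
    · intro hk
      exact absurd (Finset.mem_range.2 h2.2) hk
  · refine Finset.sum_eq_zero fun k hk => if_neg ?_
    have := Finset.mem_range.1 hk
    omega

lemma Intertwines.apply_of_projection {m n c : ℕ} {P Q : ℕ → ℕ → R}
    (h : Intertwines n m Q P (projectionMatrix R c)) (hm : n + c ≤ m) {i j : ℕ} (hi : i < n)
    (hj : j < m) : P (i + c) j = if c ≤ j ∧ j - c < n then Q i (j - c) else 0 := by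
  have h1 := (h i hi j hj).symm
  simp only [projectionMatrix, mul_ite, mul_one, mul_zero, ite_mul, one_mul, zero_mul] at h1
  rw [Finset.sum_ite_eq', if_pos (Finset.mem_range.2 (by omega))] at h1
  rw [h1]
  split_ifs with h2
  · rw [Finset.sum_eq_single (j - c)]
    · rw [if_pos (by omega)]
    · intro k _ hk
      rw [if_neg (by omega)]
    · intro hk
      exact absurd (Finset.mem_range.2 h2.2) hk
  · refine Finset.sum_eq_zero fun k hk => if_neg ?_
    have := Finset.mem_range.1 hk
    omega

/-- One more edge of an arm whose flag is spanned by the first coordinates. The far space is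
either a subspace with `c`-dimensional quotient or a quotient by a `c`-dimensional subspace; in
both cases the flag at the near vertex has steps of size `c`, which is why the orientation does
not matter. -/
lemma IsBlockUpper.of_edge {c q : ℕ} (hc : 0 < c) {P Q : ℕ → ℕ → R}
    (hQ : IsBlockUpper c (c * q) Q)
    (h : Intertwines (c * (q + 1)) (c * q) P Q (inclusionMatrix R 0) ∨
      Intertwines (c * q) (c * (q + 1)) Q P (projectionMatrix R c)) :
    IsBlockUpper c (c * (q + 1)) P := by
  intro i hi j hj hij
  rw [Nat.mul_succ] at *
  rcases h with h | h
  · have hi' : i / c < q + 1 :=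
      (Nat.div_lt_iff_lt_mul hc).2 (by rw [mul_comm, Nat.mul_succ]; exact hi)
    have hj' : j < c * q := by
      rw [mul_comm]
      exact (Nat.div_lt_iff_lt_mul hc).1 (by omega)
    have h1 := h.apply_of_inclusion (by omega) hi hj'
    rw [add_zero] at h1
    rw [h1]
    split_ifs with h2
    · exact hQ i h2.2 j hj' hij
    · rfl
  · obtain ⟨i, rfl⟩ : ∃ k, i = k + c := by
      refine ⟨i - c, ?_⟩
      by_contra h1
      rw [Nat.div_eq_of_lt (by omega : i < c)] at hij
      exact Nat.not_lt_zero _ hij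
    rw [h.apply_of_projection le_rfl (by omega) hj]
    split_ifs with h2
    · refine hQ i (by omega) (j - c) h2.2 ?_
      obtain ⟨j, rfl⟩ := Nat.exists_eq_add_of_le' h2.1
      rw [Nat.add_div_right _ hc, Nat.add_div_right _ hc] at hij
      rw [Nat.add_sub_cancel]
      omega
    · rfl

/-- One more edge of an arm whose flag is spanned by the last coordinates. -/
lemma IsBlockLower.of_edge {c q : ℕ} (hc : 0 < c) {P Q : ℕ → ℕ → R}
    (hQ : IsBlockLower c (c * q) Q)
    (h : Intertwines (c * (q + 1)) (c * q) P Q (inclusionMatrix R c) ∨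
      Intertwines (c * q) (c * (q + 1)) Q P (projectionMatrix R 0)) :
    IsBlockLower c (c * (q + 1)) P := by
  intro i hi j hj hij
  rw [Nat.mul_succ] at *
  rcases h with h | h
  · obtain ⟨j, rfl⟩ : ∃ k, j = k + c := by
      refine ⟨j - c, ?_⟩
      by_contra h1
      rw [Nat.div_eq_of_lt (by omega : j < c)] at hij
      exact Nat.not_lt_zero _ hij
    rw [h.apply_of_inclusion le_rfl hi (by omega)]
    split_ifs with h2
    · refine hQ (i - c) h2.2 j (by omega) ?_
      obtain ⟨i, rfl⟩ := Nat.exists_eq_add_of_le' h2.1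
      rw [Nat.add_div_right _ hc, Nat.add_div_right _ hc] at hij
      rw [Nat.add_sub_cancel]
      omega
    · rfl
  · have hj' : j / c < q + 1 :=
      (Nat.div_lt_iff_lt_mul hc).2 (by rw [mul_comm, Nat.mul_succ]; exact hj)
    have hi' : i < c * q := by
      rw [mul_comm]
      exact (Nat.div_lt_iff_lt_mul hc).1 (by omega)
    have h1 := h.apply_of_projection (by omega) hi' hj
    rw [add_zero] at h1
    rw [h1]
    split_ifs with h2
    · exact hQ i hi' j h2.2 hij
    · rfl

lemma IsScalarMatrix.of_edge {m n c d : ℕ} {P Q : ℕ → ℕ → R} {ε : R}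
    (hP : IsScalarMatrix m P ε)
    (h : Intertwines m n P Q (inclusionMatrix R c) ∨ Intertwines n m Q P (projectionMatrix R d))
    (hc : n + c ≤ m) (hd : n + d ≤ m) : IsScalarMatrix n Q ε := by
  intro i hi j hj
  rcases h with h | h
  · have h1 := h.apply_of_inclusion hc (i := i + c) (by omega) hj
    rw [if_pos (by omega), Nat.add_sub_cancel, hP _ (by omega) _ (by omega)] at h1
    rw [← h1]
    simp
  · have h1 := h.apply_of_projection hd (j := j + d) hi (by omega)
    rw [if_pos (by omega), Nat.add_sub_cancel, hP _ (by omega) _ (by omega)] at h1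
    rw [← h1]
    simp

/-- The matrix with the given rows, extended by zero. -/
def matrixOfRows (l : List (List R)) (i j : ℕ) : R := (l.getD i []).getD j 0

/-- An endomorphism of the near space compatible with the subspace `im ι = ker π` maps it into
itself. -/
lemma sum_eq_zero_of_edge {m n : ℕ} {P Q ι π : ℕ → ℕ → R}
    (h : Intertwines m n P Q ι ∨ Intertwines n m Q P π)
    (hπι : ∀ a < n, ∀ b < n, ∑ k ∈ Finset.range m, π a k * ι k b = 0) :
    ∀ a < n, ∀ b < n,
      ∑ i ∈ Finset.range m, ∑ k ∈ Finset.range m, π a i * P i k * ι k b = 0 := by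
  intro a ha b hb
  rcases h with h | h
  · have h1 : ∀ i ∈ Finset.range m, ∑ k ∈ Finset.range m, π a i * P i k * ι k b =
        ∑ k ∈ Finset.range n, π a i * ι i k * Q k b := fun i hi => by
      simp only [mul_assoc, ← Finset.mul_sum]
      rw [h i (Finset.mem_range.1 hi) b hb]
    rw [Finset.sum_congr rfl h1, Finset.sum_comm]
    refine Finset.sum_eq_zero fun k hk => ?_
    rw [← Finset.sum_mul, hπι a ha k (Finset.mem_range.1 hk), zero_mul]
  · rw [Finset.sum_comm]
    have h1 : ∀ k ∈ Finset.range m, ∑ i ∈ Finset.range m, π a i * P i k * ι k b =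
        ∑ i ∈ Finset.range n, Q a i * (π i k * ι k b) := fun k hk => by
      simp only [← mul_assoc, ← Finset.sum_mul]
      rw [h a ha k (Finset.mem_range.1 hk)]
    rw [Finset.sum_congr rfl h1, Finset.sum_comm]
    refine Finset.sum_eq_zero fun i hi => ?_
    rw [← Finset.mul_sum, hπι i (Finset.mem_range.1 hi) b hb, mul_zero]

/-- If some rows of `ι` and some columns of `π` form identity matrices, then an endomorphism which
is `0` or `1` on the near space is so on the far space. -/
lemma IsScalarMatrix.of_edge_of_rows {m n : ℕ} {P Q ι π : ℕ → ℕ → R} {ε : R}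
    (hP : IsScalarMatrix m P ε) (hε : ε = 0 ∨ ε = 1)
    (h : Intertwines m n P Q ι ∨ Intertwines n m Q P π) (r c : ℕ → ℕ)
    (hr : ∀ a < n, r a < m ∧ ∀ b < n, ι (r a) b = if a = b then 1 else 0)
    (hc : ∀ b < n, c b < m ∧ ∀ a < n, π a (c b) = if a = b then 1 else 0) :
    IsScalarMatrix n Q ε := by
  have hε' (x : R) : x * ε = ε * x := by rcases hε with rfl | rfl <;> simp
  intro i hi j hj
  rcases h with h | h
  · have h1 := h (r i) (hr i hi).1 j hj
    rw [Finset.sum_congr rfl (g := fun k => if r i = k then ε * ι k j else 0) fun k hk => by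
      rw [hP _ (hr i hi).1 _ (Finset.mem_range.1 hk), ite_mul, zero_mul],
      Finset.sum_ite_eq, if_pos (Finset.mem_range.2 (hr i hi).1), (hr i hi).2 j hj,
      Finset.sum_congr rfl (g := fun k => if i = k then Q k j else 0) fun k hk => by
        rw [(hr i hi).2 k (Finset.mem_range.1 hk), ite_mul, one_mul, zero_mul],
      Finset.sum_ite_eq, if_pos (Finset.mem_range.2 hi), mul_ite, mul_one, mul_zero] at h1
    exact h1.symm
  · have h1 := h i hi (c j) (hc j hj).1
    rw [Finset.sum_congr rfl (g := fun k => if k = j then Q i k else 0) fun k hk => by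
      rw [(hc j hj).2 k (Finset.mem_range.1 hk), mul_ite, mul_one, mul_zero],
      Finset.sum_ite_eq', if_pos (Finset.mem_range.2 hj),
      Finset.sum_congr rfl (g := fun k => if k = c j then π i k * ε else 0) fun k hk => by
        rw [hP _ (Finset.mem_range.1 hk) _ (hc j hj).1, mul_ite, mul_zero],
      Finset.sum_ite_eq', if_pos (Finset.mem_range.2 (hc j hj).1), (hc j hj).2 i hi, ite_mul,
      one_mul, zero_mul] at h1
    exact h1

/-- The only idempotents of `R` commuting with `S` are `0` and `1`. -/
def CommutantHasTrivialIdempotents (S : R) : Prop :=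
  ∀ a : R, a * S = S * a → a * a = a → a = 0 ∨ a = 1

lemma CommutantHasTrivialIdempotents.eq_zero_or_one_of_isScalarMatrix {S : R}
    (hS : CommutantHasTrivialIdempotents S) {n : ℕ} (hn : 0 < n) {P : ℕ → ℕ → R} {a : R}
    (hP : IsScalarMatrix n P a)
    (ha : a * S = S * a)
    (hPP : ∀ i < n, ∀ j < n, ∑ k ∈ Finset.range n, P i k * P k j = P i j) : a = 0 ∨ a = 1 := by
  refine hS a ha ?_
  have h := hPP 0 hn 0 hn
  rw [Finset.sum_eq_single 0 (fun k hk hk0 => by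
    rw [hP 0 hn k (Finset.mem_range.1 hk), if_neg hk0.symm, zero_mul])
    (fun h0 => absurd (Finset.mem_range.2 hn) h0), hP 0 hn 0 hn, if_pos rfl] at h
  exact h

end Arms

/-! ### The exceptional extended Dynkin diagrams -/

section Exceptional

variable {R : Type*} [Ring R]

/-- The diagram `Ẽ_8` with the dimensions of its null root. The long arm carries the flag of the
first coordinates, the arm of length two the flag, with steps of size two, of the last coordinates,
and the short arm the subspace of all `(x, y - x, y, z - y, z, x - S z)`. -/
def diagramE8 (S : R) : MatrixDiagram R (Fin 9) (Fin 8) where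
  dim := ![6, 5, 4, 3, 2, 1, 4, 2, 3]
  near := ![0, 1, 2, 3, 4, 0, 6, 0]
  far := ![1, 2, 3, 4, 5, 6, 7, 8]
  inward :=
    ![inclusionMatrix R 0, inclusionMatrix R 0, inclusionMatrix R 0, inclusionMatrix R 0,
      inclusionMatrix R 0, inclusionMatrix R 2, inclusionMatrix R 2,
      matrixOfRows [[1, 0, 0], [-1, 1, 0], [0, 1, 0], [0, -1, 1], [0, 0, 1], [1, 0, -S]]]
  outward :=
    ![projectionMatrix R 1, projectionMatrix R 1, projectionMatrix R 1, projectionMatrix R 1,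
      projectionMatrix R 1, projectionMatrix R 0, projectionMatrix R 0,
      matrixOfRows [[1, 1, -1, 0, 0, 0], [0, 0, 1, 1, -1, 0], [-1, 0, 0, 0, S, 1]]]

theorem diagramE8_hasTrivialIdempotents {S : R} (hS : CommutantHasTrivialIdempotents S) :
    (diagramE8 S).HasTrivialIdempotents := by
  intro p hpp h
  have h0 : Intertwines 6 5 (p 0) (p 1) (inclusionMatrix R 0) ∨
    Intertwines 5 6 (p 1) (p 0) (projectionMatrix R 1) := h 0
  have h1 : Intertwines 5 4 (p 1) (p 2) (inclusionMatrix R 0) ∨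
    Intertwines 4 5 (p 2) (p 1) (projectionMatrix R 1) := h 1
  have h2 : Intertwines 4 3 (p 2) (p 3) (inclusionMatrix R 0) ∨
    Intertwines 3 4 (p 3) (p 2) (projectionMatrix R 1) := h 2
  have h3 : Intertwines 3 2 (p 3) (p 4) (inclusionMatrix R 0) ∨
    Intertwines 2 3 (p 4) (p 3) (projectionMatrix R 1) := h 3
  have h4 : Intertwines 2 1 (p 4) (p 5) (inclusionMatrix R 0) ∨
    Intertwines 1 2 (p 5) (p 4) (projectionMatrix R 1) := h 4
  have h5 : Intertwines 6 4 (p 0) (p 6) (inclusionMatrix R 2) ∨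
    Intertwines 4 6 (p 6) (p 0) (projectionMatrix R 0) := h 5
  have h6 : Intertwines 4 2 (p 6) (p 7) (inclusionMatrix R 2) ∨
    Intertwines 2 4 (p 7) (p 6) (projectionMatrix R 0) := h 6
  have h7 := h 7
  change Intertwines 6 3 (p 0) (p 8) (matrixOfRows _) ∨
    Intertwines 3 6 (p 8) (p 0) (matrixOfRows _) at h7
  -- The two coordinate flags make the central endomorphism triangular in diagonal blocks.
  have hU : IsBlockUpper 1 6 (p 0) := (((((isBlockUpper_self 1 (p 5)).of_edge (q := 1) one_pos
    h4).of_edge (q := 2) one_pos h3).of_edge (q := 3) one_pos h2).of_edge (q := 4) one_pos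
    h1).of_edge (q := 5) one_pos h0
  have hL : IsBlockLower 2 6 (p 0) := ((isBlockLower_self 2 (p 7)).of_edge (q := 1) two_pos
    h6).of_edge (q := 2) two_pos h5
  have hW := sum_eq_zero_of_edge h7 (by
    intro a ha b hb
    interval_cases a <;> interval_cases b <;> simp [Finset.sum_range_succ, matrixOfRows])
  have hu (i j : ℕ) (hi : i < 6) (hj : j < i) : p 0 i j = 0 :=
    hU i hi j (hj.trans hi) (by simpa using hj)
  have hl (i j : ℕ) (hj : j < 6) (hi : i / 2 < j / 2) : p 0 i j = 0 :=
    hL i (by omega) j hj hi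
  -- The subspace on the short arm links the remaining entries.
  have e00 := hW 0 (by norm_num) 0 (by norm_num)
  have e01 := hW 0 (by norm_num) 1 (by norm_num)
  have e02 := hW 0 (by norm_num) 2 (by norm_num)
  have e10 := hW 1 (by norm_num) 0 (by norm_num)
  have e11 := hW 1 (by norm_num) 1 (by norm_num)
  have e12 := hW 1 (by norm_num) 2 (by norm_num)
  have e20 := hW 2 (by norm_num) 0 (by norm_num)
  have e21 := hW 2 (by norm_num) 1 (by norm_num)
  have e22 := hW 2 (by norm_num) 2 (by norm_num)
  simp [Finset.sum_range_succ, matrixOfRows, hu, hl] at e00 e01 e02 e10 e11 e12 e20 e21 e22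
  obtain ⟨d1, d2, d3, d4, d5, hcomm⟩ : p 0 1 1 = p 0 0 0 ∧ p 0 2 2 = p 0 0 0 ∧
      p 0 3 3 = p 0 0 0 ∧ p 0 4 4 = p 0 0 0 ∧ p 0 5 5 = p 0 0 0 ∧
      p 0 0 0 * S = S * p 0 0 0 := by
    clear h h0 h1 h2 h3 h4 h5 h6 h7 hU hL hW hu hl hpp hS
    simp only [e02, e10, e21, mul_zero, zero_mul, neg_zero, add_zero, zero_add,
      ← sub_eq_add_neg, sub_eq_zero, neg_add_eq_zero] at *
    grind
  have hc : IsScalarMatrix 6 (p 0) (p 0 0 0) := by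
    intro i hi j hj
    interval_cases i <;> interval_cases j <;> simp [hu, hl, e02, e10, e21, d1, d2, d3, d4, d5]
  have hε := hS.eq_zero_or_one_of_isScalarMatrix (by norm_num) hc hcomm (hpp 0)
  have s1 : IsScalarMatrix 5 (p 1) (p 0 0 0) := hc.of_edge h0 (by norm_num) (by norm_num)
  have s2 : IsScalarMatrix 4 (p 2) (p 0 0 0) := s1.of_edge h1 (by norm_num) (by norm_num)
  have s3 : IsScalarMatrix 3 (p 3) (p 0 0 0) := s2.of_edge h2 (by norm_num) (by norm_num)
  have s4 : IsScalarMatrix 2 (p 4) (p 0 0 0) := s3.of_edge h3 (by norm_num) (by norm_num)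
  have s5 : IsScalarMatrix 1 (p 5) (p 0 0 0) := s4.of_edge h4 (by norm_num) (by norm_num)
  have s6 : IsScalarMatrix 4 (p 6) (p 0 0 0) := hc.of_edge h5 (by norm_num) (by norm_num)
  have s7 : IsScalarMatrix 2 (p 7) (p 0 0 0) := s6.of_edge h6 (by norm_num) (by norm_num)
  have s8 : IsScalarMatrix 3 (p 8) (p 0 0 0) :=
    hc.of_edge_of_rows hε h7 (fun a => 2 * a) (fun a => 2 * a + 1)
      (fun a ha => ⟨by omega, fun b hb => by
        interval_cases a <;> interval_cases b <;> simp [matrixOfRows]⟩)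
      (fun b hb => ⟨by omega, fun a ha => by
        interval_cases a <;> interval_cases b <;> simp [matrixOfRows]⟩)
  refine ⟨p 0 0 0, hε, fun v => ?_⟩
  fin_cases v
  exacts [hc, s1, s2, s3, s4, s5, s6, s7, s8]

/-- The diagram `Ẽ_7` with the dimensions of its null root. The long arms carry the two opposite
coordinate flags, and the short arm the subspace of all `(x, y, x + y, x + S y)`. -/
def diagramE7 (S : R) : MatrixDiagram R (Fin 8) (Fin 7) where
  dim := ![4, 3, 2, 1, 3, 2, 1, 2]
  near := ![0, 1, 2, 0, 4, 5, 0]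
  far := ![1, 2, 3, 4, 5, 6, 7]
  inward :=
    ![inclusionMatrix R 0, inclusionMatrix R 0, inclusionMatrix R 0, inclusionMatrix R 1,
      inclusionMatrix R 1, inclusionMatrix R 1, matrixOfRows [[1, 0], [0, 1], [1, 1], [1, S]]]
  outward :=
    ![projectionMatrix R 1, projectionMatrix R 1, projectionMatrix R 1, projectionMatrix R 0,
      projectionMatrix R 0, projectionMatrix R 0, matrixOfRows [[-1, -1, 1, 0], [-1, -S, 0, 1]]]

theorem diagramE7_hasTrivialIdempotents {S : R} (hS : CommutantHasTrivialIdempotents S) :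
    (diagramE7 S).HasTrivialIdempotents := by
  intro p hpp h
  have h0 : Intertwines 4 3 (p 0) (p 1) (inclusionMatrix R 0) ∨
    Intertwines 3 4 (p 1) (p 0) (projectionMatrix R 1) := h 0
  have h1 : Intertwines 3 2 (p 1) (p 2) (inclusionMatrix R 0) ∨
    Intertwines 2 3 (p 2) (p 1) (projectionMatrix R 1) := h 1
  have h2 : Intertwines 2 1 (p 2) (p 3) (inclusionMatrix R 0) ∨
    Intertwines 1 2 (p 3) (p 2) (projectionMatrix R 1) := h 2
  have h3 : Intertwines 4 3 (p 0) (p 4) (inclusionMatrix R 1) ∨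
    Intertwines 3 4 (p 4) (p 0) (projectionMatrix R 0) := h 3
  have h4 : Intertwines 3 2 (p 4) (p 5) (inclusionMatrix R 1) ∨
    Intertwines 2 3 (p 5) (p 4) (projectionMatrix R 0) := h 4
  have h5 : Intertwines 2 1 (p 5) (p 6) (inclusionMatrix R 1) ∨
    Intertwines 1 2 (p 6) (p 5) (projectionMatrix R 0) := h 5
  have h6 := h 6
  change Intertwines 4 2 (p 0) (p 7) (matrixOfRows _) ∨
    Intertwines 2 4 (p 7) (p 0) (matrixOfRows _) at h6
  have hU : IsBlockUpper 1 4 (p 0) := (((isBlockUpper_self 1 (p 3)).of_edge (q := 1) one_pos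
    h2).of_edge (q := 2) one_pos h1).of_edge (q := 3) one_pos h0
  have hL : IsBlockLower 1 4 (p 0) := (((isBlockLower_self 1 (p 6)).of_edge (q := 1) one_pos
    h5).of_edge (q := 2) one_pos h4).of_edge (q := 3) one_pos h3
  have hW := sum_eq_zero_of_edge h6 (by
    intro a ha b hb
    interval_cases a <;> interval_cases b <;> simp [Finset.sum_range_succ, matrixOfRows])
  have hu (i j : ℕ) (hi : i < 4) (hj : j < i) : p 0 i j = 0 :=
    hU i hi j (hj.trans hi) (by simpa using hj)
  have hl (i j : ℕ) (hj : j < 4) (hi : i < j) : p 0 i j = 0 :=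
    hL i (hi.trans hj) j hj (by simpa using hi)
  have e00 := hW 0 (by norm_num) 0 (by norm_num)
  have e01 := hW 0 (by norm_num) 1 (by norm_num)
  have e10 := hW 1 (by norm_num) 0 (by norm_num)
  have e11 := hW 1 (by norm_num) 1 (by norm_num)
  simp [Finset.sum_range_succ, matrixOfRows, hu, hl] at e00 e01 e10 e11
  obtain ⟨d1, d2, d3, hcomm⟩ : p 0 1 1 = p 0 0 0 ∧ p 0 2 2 = p 0 0 0 ∧
      p 0 3 3 = p 0 0 0 ∧ p 0 0 0 * S = S * p 0 0 0 := by
    clear h h0 h1 h2 h3 h4 h5 h6 hU hL hW hu hl hpp hS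
    grind
  have hc : IsScalarMatrix 4 (p 0) (p 0 0 0) := by
    intro i hi j hj
    interval_cases i <;> interval_cases j <;> simp [hu, hl, d1, d2, d3]
  have hε := hS.eq_zero_or_one_of_isScalarMatrix (by norm_num) hc hcomm (hpp 0)
  have s1 : IsScalarMatrix 3 (p 1) (p 0 0 0) := hc.of_edge h0 (by norm_num) (by norm_num)
  have s2 : IsScalarMatrix 2 (p 2) (p 0 0 0) := s1.of_edge h1 (by norm_num) (by norm_num)
  have s3 : IsScalarMatrix 1 (p 3) (p 0 0 0) := s2.of_edge h2 (by norm_num) (by norm_num)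
  have s4 : IsScalarMatrix 3 (p 4) (p 0 0 0) := hc.of_edge h3 (by norm_num) (by norm_num)
  have s5 : IsScalarMatrix 2 (p 5) (p 0 0 0) := s4.of_edge h4 (by norm_num) (by norm_num)
  have s6 : IsScalarMatrix 1 (p 6) (p 0 0 0) := s5.of_edge h5 (by norm_num) (by norm_num)
  have s7 : IsScalarMatrix 2 (p 7) (p 0 0 0) :=
    hc.of_edge_of_rows hε h6 (fun a => a) (fun a => a + 2)
      (fun a ha => ⟨by omega, fun b hb => by
        interval_cases a <;> interval_cases b <;> simp [matrixOfRows]⟩)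
      (fun b hb => ⟨by omega, fun a ha => by
        interval_cases a <;> interval_cases b <;> simp [matrixOfRows]⟩)
  refine ⟨p 0 0 0, hε, fun v => ?_⟩
  fin_cases v
  exacts [hc, s1, s2, s3, s4, s5, s6, s7]

/-- The diagram `Ẽ_6` with the dimensions of its null root. Two arms carry the opposite coordinate
flags; the third one carries the flag of the line spanned by `(1, 1, 1)` inside the plane spanned
by `(1, 1, 1)` and `(0, S, 1)`. For an outward edge at the centre, the far space is the quotient by
that line, in coordinates for which the image of the plane is the first axis. -/
def diagramE6 (S : R) : MatrixDiagram R (Fin 7) (Fin 6) where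
  dim := ![3, 2, 1, 2, 1, 2, 1]
  near := ![0, 1, 0, 3, 0, 5]
  far := ![1, 2, 3, 4, 5, 6]
  inward :=
    ![inclusionMatrix R 0, inclusionMatrix R 0, inclusionMatrix R 1, inclusionMatrix R 1,
      matrixOfRows [[1, 0], [1, S], [1, 1]], inclusionMatrix R 0]
  outward :=
    ![projectionMatrix R 1, projectionMatrix R 1, projectionMatrix R 0, projectionMatrix R 0,
      matrixOfRows [[-1, 0, 1], [S - 1, 1, -S]], projectionMatrix R 1]

theorem diagramE6_hasTrivialIdempotents {S : R} (hS : CommutantHasTrivialIdempotents S) :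
    (diagramE6 S).HasTrivialIdempotents := by
  intro p hpp h
  have h0 : Intertwines 3 2 (p 0) (p 1) (inclusionMatrix R 0) ∨
    Intertwines 2 3 (p 1) (p 0) (projectionMatrix R 1) := h 0
  have h1 : Intertwines 2 1 (p 1) (p 2) (inclusionMatrix R 0) ∨
    Intertwines 1 2 (p 2) (p 1) (projectionMatrix R 1) := h 1
  have h2 : Intertwines 3 2 (p 0) (p 3) (inclusionMatrix R 1) ∨
    Intertwines 2 3 (p 3) (p 0) (projectionMatrix R 0) := h 2
  have h3 : Intertwines 2 1 (p 3) (p 4) (inclusionMatrix R 1) ∨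
    Intertwines 1 2 (p 4) (p 3) (projectionMatrix R 0) := h 3
  have h4 := h 4
  change Intertwines 3 2 (p 0) (p 5) (matrixOfRows _) ∨
    Intertwines 2 3 (p 5) (p 0) (matrixOfRows _) at h4
  have h5 : Intertwines 2 1 (p 5) (p 6) (inclusionMatrix R 0) ∨
    Intertwines 1 2 (p 6) (p 5) (projectionMatrix R 1) := h 5
  have hU : IsBlockUpper 1 3 (p 0) := ((isBlockUpper_self 1 (p 2)).of_edge (q := 1) one_pos
    h1).of_edge (q := 2) one_pos h0
  have hL : IsBlockLower 1 3 (p 0) := ((isBlockLower_self 1 (p 4)).of_edge (q := 1) one_pos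
    h3).of_edge (q := 2) one_pos h2
  have h10 : p 5 1 0 = 0 := ((isBlockUpper_self 1 (p 6)).of_edge (q := 1) one_pos h5)
    1 (by norm_num) 0 (by norm_num) (by norm_num)
  have hu (i j : ℕ) (hi : i < 3) (hj : j < i) : p 0 i j = 0 :=
    hU i hi j (hj.trans hi) (by simpa using hj)
  have hl (i j : ℕ) (hj : j < 3) (hi : i < j) : p 0 i j = 0 :=
    hL i (hi.trans hj) j hj (by simpa using hi)
  have key : p 0 1 1 = p 0 0 0 ∧ p 0 2 2 = p 0 0 0 ∧ p 0 0 0 * S = S * p 0 0 0 ∧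
      p 5 0 0 = p 0 0 0 ∧ p 5 0 1 = 0 ∧ p 5 1 1 = p 0 0 0 := by
    rcases h4 with h4 | h4
    · have e00 := h4 0 (by norm_num) 0 (by norm_num)
      have e01 := h4 0 (by norm_num) 1 (by norm_num)
      have e10 := h4 1 (by norm_num) 0 (by norm_num)
      have e11 := h4 1 (by norm_num) 1 (by norm_num)
      have e20 := h4 2 (by norm_num) 0 (by norm_num)
      have e21 := h4 2 (by norm_num) 1 (by norm_num)
      simp [Finset.sum_range_succ, matrixOfRows, hu, hl, h10] at e00 e01 e10 e11 e20 e21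
      clear h h0 h1 h2 h3 h4 h5 hU hL hu hl hpp hS
      grind
    · have e00 := h4 0 (by norm_num) 0 (by norm_num)
      have e01 := h4 0 (by norm_num) 1 (by norm_num)
      have e02 := h4 0 (by norm_num) 2 (by norm_num)
      have e10 := h4 1 (by norm_num) 0 (by norm_num)
      have e11 := h4 1 (by norm_num) 1 (by norm_num)
      have e12 := h4 1 (by norm_num) 2 (by norm_num)
      simp [Finset.sum_range_succ, matrixOfRows, hu, hl, h10] at e00 e01 e02 e10 e11 e12
      simp only [e01, zero_mul, add_zero, neg_zero, neg_inj] at e00 e02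
      have e2 : p 0 2 2 = p 0 0 0 := by rw [← e02, e00]
      simp only [mul_sub, sub_mul, mul_one, one_mul] at e10
      rw [e12, e2, sub_right_inj] at e10
      rw [e10, e2] at e12
      exact ⟨e11.symm.trans e10, e2, e12, e00, e01, e10⟩
  obtain ⟨d1, d2, hcomm, d3, d4, d5⟩ := key
  have hc : IsScalarMatrix 3 (p 0) (p 0 0 0) := by
    intro i hi j hj
    interval_cases i <;> interval_cases j <;> simp [hu, hl, d1, d2]
  have hε := hS.eq_zero_or_one_of_isScalarMatrix (by norm_num) hc hcomm (hpp 0)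
  have s1 : IsScalarMatrix 2 (p 1) (p 0 0 0) := hc.of_edge h0 (by norm_num) (by norm_num)
  have s2 : IsScalarMatrix 1 (p 2) (p 0 0 0) := s1.of_edge h1 (by norm_num) (by norm_num)
  have s3 : IsScalarMatrix 2 (p 3) (p 0 0 0) := hc.of_edge h2 (by norm_num) (by norm_num)
  have s4 : IsScalarMatrix 1 (p 4) (p 0 0 0) := s3.of_edge h3 (by norm_num) (by norm_num)
  have s5 : IsScalarMatrix 2 (p 5) (p 0 0 0) := by
    intro i hi j hj
    interval_cases i <;> interval_cases j <;> simp [d3, d4, d5, h10]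
  have s6 : IsScalarMatrix 1 (p 6) (p 0 0 0) := s5.of_edge h5 (by norm_num) (by norm_num)
  refine ⟨p 0 0 0, hε, fun v => ?_⟩
  fin_cases v
  exacts [hc, s1, s2, s3, s4, s5, s6]

end Exceptional

/-! ### The infinite families -/

section Families

variable {R : Type*} [Ring R]

/-- The diagram `Ã_n`, with one copy of the Hilbert space at every vertex, `S` on one edge and the
identity on the others. In the case of a loop, `near` and `far` coincide and both matrices are
the same, so that the direction of the edge is irrelevant. -/
def diagramA (S : R) (n : ℕ) : MatrixDiagram R (Fin (n + 1)) (Fin (n + 1)) where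
  dim _ := 1
  near i := i
  far i := i + 1
  inward i _ _ := if i = Fin.last n then S else 1
  outward i _ _ := if i = Fin.last n then S else 1

theorem diagramA_hasTrivialIdempotents {S : R} (hS : CommutantHasTrivialIdempotents S) (n : ℕ) :
    (diagramA S n).HasTrivialIdempotents := by
  intro p hpp h
  have hstep (i : Fin (n + 1)) :
      p i 0 0 * (if i = Fin.last n then S else 1) =
        (if i = Fin.last n then S else 1) * p (i + 1) 0 0 ∨
      p (i + 1) 0 0 * (if i = Fin.last n then S else 1) =
        (if i = Fin.last n then S else 1) * p i 0 0 := by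
    refine (h i).imp (fun h => ?_) fun h => ?_
    · simpa [diagramA] using h 0 Nat.one_pos 0 Nat.one_pos
    · simpa [diagramA] using h 0 Nat.one_pos 0 Nat.one_pos
  have hall (i : Fin (n + 1)) : p i 0 0 = p 0 0 0 := by
    induction i using Fin.induction with
    | zero => rfl
    | succ i ih =>
      have h1 := hstep i.castSucc
      rw [if_neg (Fin.castSucc_lt_last i).ne, Fin.coeSucc_eq_succ] at h1
      simp only [mul_one, one_mul] at h1
      rcases h1 with h1 | h1
      · rw [← h1, ih]
      · rw [h1, ih]
  have hcomm : p 0 0 0 * S = S * p 0 0 0 := by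
    have h1 := hstep (Fin.last n)
    rw [if_pos rfl, hall, hall (Fin.last n + 1)] at h1
    exact h1.elim id id
  have hc (v : Fin (n + 1)) : IsScalarMatrix 1 (p v) (p 0 0 0) := by
    intro i hi j hj
    interval_cases i
    interval_cases j
    rw [if_pos rfl, hall]
  exact ⟨p 0 0 0, hS.eq_zero_or_one_of_isScalarMatrix Nat.one_pos (hc 0) hcomm (hpp 0), hc⟩

/-- The diagram `D̃_n` with the dimensions of its null root. The edges of the path from `2` to
`n - 2` carry identities, so that all four end vertices define lines in the same plane: the
two axes at `0` and `1`, and the lines spanned by `(1, S)` and `(1, 1)` at `n - 1` and `n`. -/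
def diagramD (S : R) (n : ℕ) (hn : 4 ≤ n) : MatrixDiagram R (Fin (n + 1)) (Fin n) where
  dim v := if v.val < 2 ∨ n - 1 ≤ v.val then 1 else 2
  near i :=
    if i.val < 2 then ⟨2, by omega⟩
    else if i.val = n - 1 then ⟨n - 2, by omega⟩ else ⟨i.val, by omega⟩
  far i :=
    if i.val < 2 then ⟨i.val, by omega⟩
    else ⟨i.val + 1, by omega⟩
  inward i :=
    if i.val = 0 then matrixOfRows [[1], [0]]
    else if i.val = 1 then matrixOfRows [[0], [1]]
    else if i.val = n - 1 then matrixOfRows [[1], [1]]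
    else if i.val = n - 2 then matrixOfRows [[1], [S]]
    else inclusionMatrix R 0
  outward i :=
    if i.val = 0 then matrixOfRows [[0, 1]]
    else if i.val = 1 then matrixOfRows [[1, 0]]
    else if i.val = n - 1 then matrixOfRows [[-1, 1]]
    else if i.val = n - 2 then matrixOfRows [[-S, 1]]
    else projectionMatrix R 0

lemma ofEnds_diagramD (S : R) (n : ℕ) (hn : 4 ≤ n) :
    (Graph.ofEnds fun e => s((diagramD S n hn).near e, (diagramD S n hn).far e)) =
      extendedDynkinD n hn := by
  unfold extendedDynkinD
  congr 1
  funext i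
  simp only [diagramD]
  by_cases h0 : i.val = 0
  · simp [h0, Sym2.eq_swap]
  by_cases h1 : i.val = n - 1
  · have h2 : ¬ n - 1 < 2 := by omega
    have h3 : n - 1 ≠ 0 := by omega
    have h4 : n - 1 + 1 = n := by omega
    simp [h1, h2, h3, h4]
  by_cases h2 : i.val = 1
  · have h3 : ¬ (1 = n - 1) := by omega
    simp [h2, h3]
  · have h3 : ¬ i.val < 2 := by omega
    simp [h0, h1, h3]

theorem diagramD_hasTrivialIdempotents {S : R} (hS : CommutantHasTrivialIdempotents S) (n : ℕ)
    (hn : 4 ≤ n) :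
    (diagramD S n hn).HasTrivialIdempotents := by
  intro p hpp h
  -- With `n = m + 4` no truncated subtraction remains.
  obtain ⟨m, rfl⟩ := Nat.exists_eq_add_of_le' hn
  have h0 : Intertwines 2 1 (p ⟨2, by omega⟩) (p ⟨0, by omega⟩) (matrixOfRows [[1], [0]]) ∨
      Intertwines 1 2 (p ⟨0, by omega⟩) (p ⟨2, by omega⟩) (matrixOfRows [[0, 1]]) := by
    simpa [diagramD] using h ⟨0, by omega⟩
  have h1 : Intertwines 2 1 (p ⟨2, by omega⟩) (p ⟨1, by omega⟩) (matrixOfRows [[0], [1]]) ∨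
      Intertwines 1 2 (p ⟨1, by omega⟩) (p ⟨2, by omega⟩) (matrixOfRows [[1, 0]]) := by
    simpa [diagramD] using h ⟨1, by omega⟩
  have h2 (k : ℕ) (hk : 2 ≤ k) (hk' : k < m + 2) :
      Intertwines 2 2 (p ⟨k, by omega⟩) (p ⟨k + 1, by omega⟩) (inclusionMatrix R 0) ∨
      Intertwines 2 2 (p ⟨k + 1, by omega⟩) (p ⟨k, by omega⟩) (projectionMatrix R 0) := by
    have a1 : ¬ k ≤ 1 := by omega
    have a2 : k ≠ m + 3 := by omega
    have a3 : ¬ m + 3 ≤ k := by omega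
    have a4 : ¬ m + 2 ≤ k := by omega
    have a5 : (⟨k, by omega⟩ : Fin (m + 4)) ≠ 0 := Fin.ne_of_val_ne (by simp; omega)
    have a6 : k ≠ 1 := by omega
    have a8 : k ≠ 0 := by omega
    have a7 : k ≠ m + 2 := by omega
    simpa [diagramD, a1, a2, a3, a4, a5, a6, a7, a8] using h ⟨k, by omega⟩
  have h3 : Intertwines 2 1 (p ⟨m + 2, by omega⟩) (p ⟨m + 3, by omega⟩)
        (matrixOfRows [[1], [S]]) ∨
      Intertwines 1 2 (p ⟨m + 3, by omega⟩) (p ⟨m + 2, by omega⟩)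
        (matrixOfRows [[-S, 1]]) := by
    simpa [diagramD] using h ⟨m + 2, by omega⟩
  have h4 : Intertwines 2 1 (p ⟨m + 2, by omega⟩) (p ⟨m + 4, by omega⟩)
        (matrixOfRows [[1], [1]]) ∨
      Intertwines 1 2 (p ⟨m + 4, by omega⟩) (p ⟨m + 2, by omega⟩)
        (matrixOfRows [[-1, 1]]) := by
    simpa [diagramD] using h ⟨m + 3, by omega⟩
  -- Along the middle path all endomorphisms agree.
  have hmid (k : ℕ) (hk : k < m + 1) : ∀ i < 2, ∀ j < 2,
      p ⟨k + 2, by omega⟩ i j = p ⟨2, by omega⟩ i j := by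
    induction k with
    | zero => intros; rfl
    | succ k ih =>
      intro i hi j hj
      rw [← ih (by omega) i hi j hj]
      rcases h2 (k + 2) (by omega) (by omega) with h | h
      · simpa [hi] using (h.apply_of_inclusion le_rfl hi hj).symm
      · simpa [hj] using (h.apply_of_projection le_rfl hi hj).symm
  have e0 := sum_eq_zero_of_edge h0 (by
    intro a ha b hb
    interval_cases a; interval_cases b; simp [Finset.sum_range_succ, matrixOfRows])
    0 Nat.one_pos 0 Nat.one_pos
  have e1 := sum_eq_zero_of_edge h1 (by
    intro a ha b hb
    interval_cases a; interval_cases b; simp [Finset.sum_range_succ, matrixOfRows])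
    0 Nat.one_pos 0 Nat.one_pos
  have e3 := sum_eq_zero_of_edge h3 (by
    intro a ha b hb
    interval_cases a; interval_cases b; simp [Finset.sum_range_succ, matrixOfRows])
    0 Nat.one_pos 0 Nat.one_pos
  have e4 := sum_eq_zero_of_edge h4 (by
    intro a ha b hb
    interval_cases a; interval_cases b; simp [Finset.sum_range_succ, matrixOfRows])
    0 Nat.one_pos 0 Nat.one_pos
  have hlast := hmid m (by omega)
  simp only [Finset.sum_range_succ, Finset.sum_range_zero, zero_add,
    hlast 0 two_pos 0 two_pos, hlast 0 two_pos 1 one_lt_two, hlast 1 one_lt_two 0 two_pos,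
    hlast 1 one_lt_two 1 one_lt_two] at e0 e1 e3 e4
  simp [matrixOfRows] at e0 e1
  simp [matrixOfRows, e0, e1, neg_add_eq_zero] at e3 e4
  have hc : IsScalarMatrix 2 (p ⟨2, by omega⟩) (p ⟨2, by omega⟩ 0 0) := by
    intro i hi j hj
    interval_cases i <;> interval_cases j <;> simp [e0, e1, e4]
  have hcomm : p ⟨2, by omega⟩ 0 0 * S = S * p ⟨2, by omega⟩ 0 0 := by
    rw [e3, ← e4]
  have hpp2 := hpp ⟨2, by omega⟩
  simp only [diagramD] at hpp2
  rw [if_neg (by simp)] at hpp2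
  have hε := hS.eq_zero_or_one_of_isScalarMatrix two_pos hc hcomm hpp2
  have hcv (k : ℕ) (hk : k < m + 1) :
      IsScalarMatrix 2 (p ⟨k + 2, by omega⟩) (p ⟨2, by omega⟩ 0 0) := by
    intro i hi j hj
    rw [hmid k hk i hi j hj, hc i hi j hj]
  have s0 := hc.of_edge_of_rows hε h0 (fun _ => 0) (fun _ => 1)
    (fun a ha => ⟨by omega, fun b hb => by
      interval_cases a; interval_cases b; simp [matrixOfRows]⟩)
    (fun b hb => ⟨by omega, fun a ha => by
      interval_cases a; interval_cases b; simp [matrixOfRows]⟩)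
  have s1 := hc.of_edge_of_rows hε h1 (fun _ => 1) (fun _ => 0)
    (fun a ha => ⟨by omega, fun b hb => by
      interval_cases a; interval_cases b; simp [matrixOfRows]⟩)
    (fun b hb => ⟨by omega, fun a ha => by
      interval_cases a; interval_cases b; simp [matrixOfRows]⟩)
  have s3 := (hcv m (by omega)).of_edge_of_rows hε h3 (fun _ => 0) (fun _ => 1)
    (fun a ha => ⟨by omega, fun b hb => by
      interval_cases a; interval_cases b; simp [matrixOfRows]⟩)
    (fun b hb => ⟨by omega, fun a ha => by
      interval_cases a; interval_cases b; simp [matrixOfRows]⟩)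
  have s4 := (hcv m (by omega)).of_edge_of_rows hε h4 (fun _ => 0) (fun _ => 1)
    (fun a ha => ⟨by omega, fun b hb => by
      interval_cases a; interval_cases b; simp [matrixOfRows]⟩)
    (fun b hb => ⟨by omega, fun a ha => by
      interval_cases a; interval_cases b; simp [matrixOfRows]⟩)
  refine ⟨_, hε, fun v => ?_⟩
  obtain ⟨k, hk⟩ := v
  simp only [diagramD]
  split_ifs with hk1
  · obtain rfl | rfl | rfl | rfl : k = 0 ∨ k = 1 ∨ k = m + 3 ∨ k = m + 4 := by
      omega
    exacts [s0, s1, s3, s4]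
  · obtain ⟨k, rfl⟩ : ∃ l, k = l + 2 := ⟨k - 2, by omega⟩
    exact hcv k (by omega)

end Families

lemma SquareSummable.commutantHasTrivialIdempotents_shift :
    CommutantHasTrivialIdempotents SquareSummable.shift :=
  SquareSummable.eq_zero_or_one_of_commute_shift

/-! ### Existence of infinite-dimensional indecomposable representations -/

theorem mainTheorem1 (Γ : Type u) [Quiver.{v} Γ] [Finite Γ] [Finite (Quiver.Total Γ)]
    (hconn : (Quiver.underlyingGraph Γ).IsConnected)
    (hΓ : (Quiver.underlyingGraph Γ).ContainsExtendedDynkin) :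
    ∃ H : HilbertRep.{u, v, 0} Γ,
      (∀ x : Γ, TopologicalSpace.SeparableSpace (H.space x)) ∧
      H.InfiniteDimensional ∧ H.Indecomposable := by
  have hS := SquareSummable.commutantHasTrivialIdempotents_shift
  rcases hΓ with ⟨n, hA⟩ | ⟨n, hn, hD⟩ | hE | hE | hE
  · exact (diagramA _ n).exists_hilbertRep (diagramA_hasTrivialIdempotents hS n) 0 one_pos hA
  · rw [← ofEnds_diagramD SquareSummable.shift n hn] at hD
    exact (diagramD _ n hn).exists_hilbertRep (diagramD_hasTrivialIdempotents hS n hn) 0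
      (by simp [diagramD]) hD
  · refine (diagramE6 _).exists_hilbertRep (diagramE6_hasTrivialIdempotents hS) 0
      (by simp [diagramE6]) ?_
    convert hE using 1
    unfold extendedDynkinE6
    congr 1
    funext e
    fin_cases e <;> rfl
  · refine (diagramE7 _).exists_hilbertRep (diagramE7_hasTrivialIdempotents hS) 0
      (by simp [diagramE7]) ?_
    convert hE using 1
    unfold extendedDynkinE7
    congr 1
    funext e
    fin_cases e <;> rfl
  · refine (diagramE8 _).exists_hilbertRep (diagramE8_hasTrivialIdempotents hS) 0
      (by simp [diagramE8]) ?_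
    convert hE using 1
    unfold extendedDynkinE8
    congr 1
    funext e
    fin_cases e <;> rfl
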